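/- Theorem 1.3. Let $R$ be a $d\times d$ integer matrix that is expansive (all its complex eigenvalues have modulus $>1$), let $B\subset\mathbb Z^d$ be finite with $0\in B$, and put $N=|B|$ and $\tau_b(x)=R^{-1}(x+b)$ for $x\in\mathbb R^d$, $b\in B$. Let $\mu=\mu(R,B)$ be the self-affine measure, i.e. the unique Borel probability measure on $\mathbb R^d$ with $\mu(E)=\frac1N\sum_{b\in B}\mu(\tau_b^{-1}(E))$ for all Borel sets $E$, and let $X_B=\{\sum_{k\ge1}R^{-k}b_k : b_k\in B\}$ be the attractor. Suppose that $\mu$ has no overlap: $\mu(\tau_b(X_B)\cap\tau_{b'}(X_B))=0$ for all $b\ne b'$ in $B$. Let $L\subset\mathbb Z^d$ be a finite set with $0\in L$ and let $(\alpha_l)_{l\in L}$ be complex numbers such that: (i) $\alpha_0=1$; (ii) the matrix $T=\frac1{\sqrt N}\left(e^{2\pi i (R^T)^{-1}l\cdot b}\,\alpha_l\right)_{l\in L,\,b\in B}$ is an isometry, i.e. $T^*T=I_N$; (iii) the only entire function $h$ on $\mathbb C^d$ such that $0\le h\le 1$ on $\mathbb R^d$, $h(0)=1$ and $$\sum_{l\in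 L}|\alpha_l|^2\left|m_B\big((R^T)^{-1}(t-l)\big)\right|^2h\big((R^T)^{-1}(t-l)\big)=h(t)\qquad(t\in\mathbb R^d)$$ is the constant function $1$, where $m_B(x)=\frac1N\sum_{b\in B}e^{2\pi i b\cdot x}$. Let $\Omega(L)=\{\emptyset\}\cup\{l_0\dots l_k : k\ge0,\ l_i\in L,\ l_k\ne0\}$ be the set consisting of the empty word and of all finite words over $L$ whose last digit is nonzero, and write $e_\lambda(x)=e^{2\pi i\lambda\cdot x}$. Then the family $$\left(\Big(\prod_{i=0}^k\alpha_{l_i}\Big)\,e_{l_0+R^Tl_1+\dots+(R^T)^kl_k}\right)_{l_0\dots l_k\in\Omega(L)},$$ in which the empty word gives the constant function $1$, is a Parseval frame for $L^2(\mu)$: for every $f\in L^2(\mu)$ the sum of $|\langle f,\cdot\rangle|^2$ over the family equals $\|f\|^2$. -/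

import Mathlib

open MeasureTheory
open scoped Matrix

namespace SelfAffine

noncomputable section

/-- An integer vector, seen in `ℝ^d`. -/
def toReal {d : ℕ} (l : Fin d → ℤ) : Fin d → ℝ := fun i => (l i : ℝ)

/-- An integer matrix, seen as a real matrix. -/
def realMatrix {d : ℕ} (R : Matrix (Fin d) (Fin d) ℤ) : Matrix (Fin d) (Fin d) ℝ :=
  R.map (fun a : ℤ => (a : ℝ))

/-- `R` is expansive: every complex eigenvalue has modulus greater than one. -/
def IsExpansive {d : ℕ} (R : Matrix (Fin d) (Fin d) ℤ) : Prop :=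
  ∀ z ∈ spectrum ℂ (R.map (fun a : ℤ => (a : ℂ))), 1 < ‖z‖

/-- The affine maps `τ_b x = R⁻¹ (x + b)`. -/
def tau {d : ℕ} (R : Matrix (Fin d) (Fin d) ℤ) (b : Fin d → ℤ) (x : Fin d → ℝ) : Fin d → ℝ :=
  (realMatrix R)⁻¹ *ᵥ (x + toReal b)

/-- The self-affine measure `μ(R, B)` with equal weights, through its defining invariance
equation: for expansive `R` and nonempty `B` exactly one Borel probability measure satisfies it. -/
def IsSelfAffineMeasure {d : ℕ} (R : Matrix (Fin d) (Fin d) ℤ) (B : Finset (Fin d → ℤ))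
    (μ : Measure (Fin d → ℝ)) [IsProbabilityMeasure μ] : Prop :=
  ∀ E : Set (Fin d → ℝ), MeasurableSet E →
    μ E = (B.card : ENNReal)⁻¹ * ∑ b ∈ B, μ (tau R b ⁻¹' E)

/-- The attractor `X_B`: all sums `∑_{k ≥ 1} R^{-k} b_k` with digits `b_k ∈ B`. -/
def attractor {d : ℕ} (R : Matrix (Fin d) (Fin d) ℤ) (B : Finset (Fin d → ℤ)) :
    Set (Fin d → ℝ) :=
  {x | ∃ b : ℕ → B, HasSum (fun k : ℕ => ((realMatrix R)⁻¹ ^ (k + 1)) *ᵥ toReal (b k).1) x}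

/-- The no overlap condition. -/
def NoOverlap {d : ℕ} (R : Matrix (Fin d) (Fin d) ℤ) (B : Finset (Fin d → ℤ))
    (μ : Measure (Fin d → ℝ)) : Prop :=
  ∀ b ∈ B, ∀ b' ∈ B, b ≠ b' →
    μ (tau R b '' attractor R B ∩ tau R b' '' attractor R B) = 0

/-- The exponential function `e_t(x) = exp(2πi t·x)`. -/
def expo {d : ℕ} (t x : Fin d → ℝ) : ℂ :=
  Complex.exp (2 * Real.pi * Complex.I * ((t ⬝ᵥ x : ℝ) : ℂ))

theorem norm_expo {d : ℕ} (t x : Fin d → ℝ) : ‖expo t x‖ = 1 := by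
  have : (2 * Real.pi * Complex.I * ((t ⬝ᵥ x : ℝ) : ℂ) : ℂ)
      = ((2 * Real.pi * (t ⬝ᵥ x) : ℝ) : ℂ) * Complex.I := by
    push_cast; ring
  rw [expo, this, Complex.norm_exp_ofReal_mul_I]

theorem continuous_expo {d : ℕ} (t : Fin d → ℝ) : Continuous (expo t) := by
  unfold expo dotProduct
  fun_prop

theorem memLp_expo {d : ℕ} (μ : Measure (Fin d → ℝ)) [IsFiniteMeasure μ] (t : Fin d → ℝ) :
    MemLp (expo t) 2 μ :=
  MemLp.of_bound (continuous_expo t).aestronglyMeasurable 1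
    (Filter.Eventually.of_forall fun x => (norm_expo t x).le)

/-- The exponential function `e_t` as an element of `L²(μ)`. -/
def expoLp {d : ℕ} (μ : Measure (Fin d → ℝ)) [IsFiniteMeasure μ] (t : Fin d → ℝ) : Lp ℂ 2 μ :=
  (memLp_expo μ t).toLp (expo t)

/-- The map `g_l(t) = (Rᵀ)⁻¹ (t - l)`. -/
def dualMap {d : ℕ} (R : Matrix (Fin d) (Fin d) ℤ) (l : Fin d → ℤ) (t : Fin d → ℝ) :
    Fin d → ℝ :=
  ((realMatrix R)ᵀ)⁻¹ *ᵥ (t - toReal l)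

/-- `m_B(x) = (1/N) ∑_{b ∈ B} exp(2πi b·x)`. -/
def mask {d : ℕ} (B : Finset (Fin d → ℤ)) (x : Fin d → ℝ) : ℂ :=
  (B.card : ℂ)⁻¹ * ∑ b ∈ B, expo (toReal b) x

/-- The matrix `T = (1/√N) (exp(2πi (Rᵀ)⁻¹ l · b) α_l)`, with rows `l ∈ L`, columns `b ∈ B`. -/
def weightMatrix {d : ℕ} (R : Matrix (Fin d) (Fin d) ℤ) (B L : Finset (Fin d → ℤ))
    (α : L → ℂ) : Matrix L B ℂ :=
  Matrix.of fun l b =>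
    ((Real.sqrt (B.card : ℝ) : ℝ) : ℂ)⁻¹ *
      (expo (((realMatrix R)ᵀ)⁻¹ *ᵥ toReal l.1) (toReal b.1) * α l)

/-- The fixed point equation of the weighted transfer operator, at all real points `t`, for a
function `h` on `ℂ^d`. -/
def IsTransferFixed {d : ℕ} (R : Matrix (Fin d) (Fin d) ℤ) (B L : Finset (Fin d → ℤ))
    (α : L → ℂ) (h : (Fin d → ℂ) → ℂ) : Prop :=
  ∀ t : Fin d → ℝ,
    ∑ l : L, ((‖α l‖ ^ 2 * ‖mask B (dualMap R l.1 t)‖ ^ 2 : ℝ) : ℂ) *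
      h (fun i => (dualMap R l.1 t i : ℂ)) = h (fun i => (t i : ℂ))

/-- `Ω(L)`: finite words over `L`, either empty or with nonzero last digit. -/
def Words {d : ℕ} (L : Finset (Fin d → ℤ)) : Type :=
  {w : List L // ∀ hw : w ≠ [], (w.getLast hw).1 ≠ 0}

/-- The frequency `l_0 + Rᵀ l_1 + ⋯ + (Rᵀ)^k l_k` of a word `l_0 … l_k`. -/
def frequency {d : ℕ} (R : Matrix (Fin d) (Fin d) ℤ) {L : Finset (Fin d → ℤ)} (w : List L) :
    Fin d → ℤ :=
  ∑ i : Fin w.length, (Rᵀ ^ (i : ℕ)) *ᵥ (w.get i).1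

/-- The weighted exponential `(∏ α_{l_i}) e_{l_0 + Rᵀ l_1 + ⋯ + (Rᵀ)^k l_k}` in `L²(μ)`;
for the empty word it is the constant function one. -/
def weightedExpo {d : ℕ} (R : Matrix (Fin d) (Fin d) ℤ) {L : Finset (Fin d → ℤ)} (α : L → ℂ)
    (μ : Measure (Fin d → ℝ)) [IsFiniteMeasure μ] (w : Words L) : Lp ℂ 2 μ :=
  (w.1.map α).prod • expoLp μ (toReal (frequency R w.1))

/-- A Parseval frame: both frame bounds are one. -/
def IsParsevalFrame {ι H : Type*} [NormedAddCommGroup H] [InnerProductSpace ℂ H]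
    (e : ι → H) : Prop :=
  ∀ v : H, HasSum (fun i => ‖inner ℂ (e i) v‖ ^ 2) (‖v‖ ^ 2)

end

end SelfAffine

/-! Write `S(f)` for the sum of the `|⟨e_w, f⟩|²` over `Ω(L)`. The operators `branch`, the adjoints
of `f ↦ α_l e_l · f ∘ 𝓡`, carry two facts. Since `T` is an isometry, `∑_l ‖branch_l f‖² = ‖f‖²`
(`sum_enorm_sq_branch`). Since digits and frequencies are integral, pairing `f` with the exponential
of the word `l w` equals pairing `branch_l f` with that of `w` (`inner_listExpo_branch`).

Prepending a digit is a bijection `L × Ω(L) → Ω(L)` once `0∅` is identified with `∅`, which is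
harmless because `α_0 = 1`. So `S(f) = ∑_l S(branch_l f)`, and induction on word length gives the
Bessel bound `S(f) ≤ ‖f‖²`: the analysis operator `Θ` is a contraction.

On exponentials, `branch_l e_t` is `conj α_l · m_B(g_l t)` times `e_{g_l t}`, so the recursion for
`S` says exactly that `h(t) = ‖Θ e_t‖²` is fixed by the transfer operator. It lies in `[0, 1]`,
equals `1` at `0` because the empty word gives `e_0`, and extends to an entire function because `μ`
has bounded support. Hypothesis (iii) forces `h = 1`, so `Θ` preserves the norm of every `e_t`. Then
the positive operator `1 - Θ*Θ` kills all `e_t`; these are total in `L²(μ)`, hence `Θ` is isometric.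
-/

namespace SelfAffine

noncomputable section

open Filter Topology
open scoped ENNReal NNReal ComplexConjugate BoundedContinuousFunction

/-! ### Decay of the powers of `R⁻¹`. -/

section PowerDecay

/-- In a complex Banach algebra, the powers of an element of spectral radius less than one are
summable in norm. -/
theorem summable_norm_pow_of_spectralRadius_lt_one {A : Type*} [NormedRing A] [NormedAlgebra ℂ A]
    [CompleteSpace A] (a : A) (ha : spectralRadius ℂ a < 1) : Summable fun n : ℕ => ‖a ^ n‖ := by
  obtain ⟨r, hr1, hr2⟩ := ENNReal.lt_iff_exists_nnreal_btwn.mp ha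
  have hr : (r : ℝ) < 1 := by exact_mod_cast hr2
  have hev : ∀ᶠ n : ℕ in atTop, ‖a ^ n‖ ≤ (r : ℝ) ^ n := by
    filter_upwards [(spectrum.pow_nnnorm_pow_one_div_tendsto_nhds_spectralRadius a).eventually
      (gt_mem_nhds hr1), eventually_gt_atTop 0] with n hn hn0
    have h1 : (‖a ^ n‖₊ : ℝ≥0∞) ≤ (r : ℝ≥0∞) ^ n := by
      have h2 := pow_le_pow_left' hn.le n
      rwa [← ENNReal.rpow_natCast, ← ENNReal.rpow_mul, one_div,
        inv_mul_cancel₀ (by positivity), ENNReal.rpow_one] at h2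
    exact_mod_cast h1
  exact (summable_geometric_of_lt_one r.2 hr).of_norm_bounded_eventually_nat
    (by filter_upwards [hev] with n hn using by simpa using hn)

attribute [local instance] Matrix.linftyOpNormedRing Matrix.linftyOpNormedAlgebra
  Matrix.linftyOpNormedAddCommGroup

variable {d : ℕ} {R : Matrix (Fin d) (Fin d) ℤ}

theorem IsExpansive.det_ne_zero (hR : IsExpansive R) : R.det ≠ 0 := by
  intro h
  have h0 : (0 : ℂ) ∈ spectrum ℂ (R.map (fun a : ℤ => (a : ℂ))) := by
    rw [spectrum.zero_mem_iff, Matrix.isUnit_iff_isUnit_det, ← Int.cast_det, h]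
    simp
  have := hR 0 h0
  norm_num at this

theorem IsExpansive.isUnit_det (hR : IsExpansive R) : IsUnit (realMatrix R).det := by
  rw [realMatrix, ← Int.cast_det]
  exact isUnit_iff_ne_zero.mpr (by exact_mod_cast hR.det_ne_zero)

/-- The eigenvalues of `R⁻¹` are the inverses of those of `R`, so its spectral radius is below one.
The spectral argument lives over `ℂ`; passing from real to complex entries preserves the norm. -/
theorem IsExpansive.summable_norm_inv_pow (hR : IsExpansive R) :
    Summable fun n : ℕ => ‖(realMatrix R)⁻¹ ^ n‖ := by
  -- For `d = 0` the matrix algebra is trivial and spectra are empty, so the bound on eigenvalues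
  -- has no content there.
  cases isEmpty_or_nonempty (Fin d) with
  | inl h =>
    have : (fun n : ℕ => ‖(realMatrix R)⁻¹ ^ n‖) = fun _ => 0 := by
      funext n
      rw [Subsingleton.elim ((realMatrix R)⁻¹ ^ n) 0, norm_zero]
    rw [this]
    exact summable_zero
  | inr h =>
    set Rc : Matrix (Fin d) (Fin d) ℂ := R.map (fun a : ℤ => (a : ℂ)) with hRc
    have hdet : IsUnit Rc.det := by
      rw [hRc, ← Int.cast_det]
      exact isUnit_iff_ne_zero.mpr (by exact_mod_cast hR.det_ne_zero)
    let u : (Matrix (Fin d) (Fin d) ℂ)ˣ := Matrix.nonsingInvUnit Rc hdet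
    have hu : ((u⁻¹ : (Matrix (Fin d) (Fin d) ℂ)ˣ) : Matrix (Fin d) (Fin d) ℂ) = Rc⁻¹ := rfl
    have hrad : spectralRadius ℂ Rc⁻¹ < 1 := by
      have := spectrum.spectralRadius_lt_of_forall_lt (A := Matrix (Fin d) (Fin d) ℂ) (r := 1)
        Rc⁻¹ (by
          intro z hz
          rw [← hu, ← spectrum.map_inv, Set.mem_inv] at hz
          have h1 := hR z⁻¹ hz
          rw [norm_inv] at h1
          have h2 : ‖z‖ < 1 := by
            by_contra h3
            exact absurd h1 (not_lt.mpr (inv_le_one_of_one_le₀ (not_lt.mp h3)))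
          exact_mod_cast h2)
      exact_mod_cast this
    have hmap : ∀ n : ℕ, (Complex.ofRealHom.mapMatrix ((realMatrix R)⁻¹ ^ n)) = Rc⁻¹ ^ n := by
      intro n
      rw [map_pow]
      congr 1
      have h1 : Complex.ofRealHom.mapMatrix (realMatrix R) = Rc := by
        ext i j
        simp [realMatrix, hRc]
      symm
      apply Matrix.inv_eq_right_inv
      rw [← h1, ← map_mul, Matrix.mul_nonsing_inv _ hR.isUnit_det, map_one]
    have hnorm : ∀ M : Matrix (Fin d) (Fin d) ℝ, ‖Complex.ofRealHom.mapMatrix M‖ = ‖M‖ := by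
      intro M
      simp [Matrix.linfty_opNorm_def]
    refine (summable_norm_pow_of_spectralRadius_lt_one Rc⁻¹ hrad).congr fun n => ?_
    rw [← hmap, hnorm]

end PowerDecay

/-! ### Consequences of the invariance equation. -/

section Invariance

variable {d : ℕ} {R : Matrix (Fin d) (Fin d) ℤ} {B : Finset (Fin d → ℤ)}
  {μ : Measure (Fin d → ℝ)} [IsProbabilityMeasure μ]

theorem continuous_tau (R : Matrix (Fin d) (Fin d) ℤ) (b : Fin d → ℤ) : Continuous (tau R b) := by
  unfold tau
  exact continuous_const.matrix_mulVec (continuous_id.add continuous_const)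

theorem measurable_tau (R : Matrix (Fin d) (Fin d) ℤ) (b : Fin d → ℤ) : Measurable (tau R b) :=
  (continuous_tau R b).measurable

theorem IsSelfAffineMeasure.eq_smul_sum_map (hμ : IsSelfAffineMeasure R B μ) :
    μ = (B.card : ℝ≥0∞)⁻¹ • ∑ b ∈ B, μ.map (tau R b) := by
  ext E hE
  rw [hμ E hE, Measure.smul_apply, Measure.finsetSum_apply, smul_eq_mul]
  congr 1
  exact Finset.sum_congr rfl fun b _ => (Measure.map_apply (measurable_tau R b) hE).symm

theorem IsSelfAffineMeasure.nonempty (hμ : IsSelfAffineMeasure R B μ) : B.Nonempty := by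
  by_contra h
  rw [Finset.not_nonempty_iff_eq_empty] at h
  have := hμ Set.univ MeasurableSet.univ
  simp [h] at this

/-- `N μ` is a sum of positive measures of which this is one term. The domination makes `f ↦ f ∘
τ_b` well defined on a.e. classes and bounded on `L^p`. -/
theorem IsSelfAffineMeasure.map_tau_le (hμ : IsSelfAffineMeasure R B μ) {b : Fin d → ℤ}
    (hb : b ∈ B) : μ.map (tau R b) ≤ (B.card : ℝ≥0∞) • μ := by
  have hN : (B.card : ℝ≥0∞) ≠ 0 := by exact_mod_cast hμ.nonempty.card_ne_zero
  have h : (B.card : ℝ≥0∞) • μ = ∑ b ∈ B, μ.map (tau R b) := by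
    conv_lhs => rw [hμ.eq_smul_sum_map]
    rw [smul_smul, ENNReal.mul_inv_cancel hN (ENNReal.natCast_ne_top _), one_smul]
  rw [h]
  refine Measure.le_iff.mpr fun s _ => ?_
  rw [Measure.finsetSum_apply]
  exact Finset.single_le_sum (f := fun b => μ.map (tau R b) s) (fun _ _ => zero_le) hb

theorem IsSelfAffineMeasure.quasiMeasurePreserving (hμ : IsSelfAffineMeasure R B μ)
    {b : Fin d → ℤ} (hb : b ∈ B) : Measure.QuasiMeasurePreserving (tau R b) μ μ :=
  ⟨measurable_tau R b, Measure.absolutelyContinuous_of_le_smul (hμ.map_tau_le hb)⟩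

theorem IsSelfAffineMeasure.memLp_comp_tau (hμ : IsSelfAffineMeasure R B μ) {b : Fin d → ℤ}
    (hb : b ∈ B) {E : Type*} [NormedAddCommGroup E] {p : ℝ≥0∞} {f : (Fin d → ℝ) → E}
    (hf : MemLp f p μ) : MemLp (fun x => f (tau R b x)) p μ :=
  (hf.of_measure_le_smul (ENNReal.natCast_ne_top _) (hμ.map_tau_le hb)).comp_of_map
    (measurable_tau R b).aemeasurable

theorem IsSelfAffineMeasure.lintegral_eq (hμ : IsSelfAffineMeasure R B μ)
    {f : (Fin d → ℝ) → ℝ≥0∞} (hf : AEMeasurable f μ) :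
    ∫⁻ x, f x ∂μ = (B.card : ℝ≥0∞)⁻¹ * ∑ b ∈ B, ∫⁻ x, f (tau R b x) ∂μ := by
  conv_lhs => rw [hμ.eq_smul_sum_map]
  rw [lintegral_smul_measure, lintegral_finsetSum_measure, smul_eq_mul]
  congr 1
  refine Finset.sum_congr rfl fun b hb => ?_
  exact lintegral_map' (hf.mono_ac (hμ.quasiMeasurePreserving hb).2)
    (measurable_tau R b).aemeasurable

theorem IsSelfAffineMeasure.integral_eq (hμ : IsSelfAffineMeasure R B μ)
    {f : (Fin d → ℝ) → ℂ} (hf : Integrable f μ) :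
    ∫ x, f x ∂μ = (B.card : ℂ)⁻¹ * ∑ b ∈ B, ∫ x, f (tau R b x) ∂μ := by
  conv_lhs => rw [hμ.eq_smul_sum_map]
  rw [integral_smul_measure, integral_finsetSum_measure]
  · simp only [ENNReal.toReal_inv, ENNReal.toReal_natCast, Complex.real_smul,
      Complex.ofReal_inv, Complex.ofReal_natCast]
    congr 1
    refine Finset.sum_congr rfl fun b hb => ?_
    exact integral_map (measurable_tau R b).aemeasurable
      (hf.1.mono_ac (hμ.quasiMeasurePreserving hb).2)
  · exact fun b hb => hf.of_measure_le_smul (ENNReal.natCast_ne_top _) (hμ.map_tau_le hb)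

end Invariance

/-! ### Bounded support of the self-affine measure. -/

section BoundedSupport

attribute [local instance] Matrix.linftyOpNormedRing Matrix.linftyOpNormedAlgebra
  Matrix.linftyOpNormedAddCommGroup

variable {d : ℕ} {R : Matrix (Fin d) (Fin d) ℤ} {B : Finset (Fin d → ℤ)}
  {μ : Measure (Fin d → ℝ)} [IsProbabilityMeasure μ]

/-- A self-affine measure is supported on a bounded set. -/
theorem IsSelfAffineMeasure.exists_ae_norm_le (hR : IsExpansive R)
    (hμ : IsSelfAffineMeasure R B μ) : ∃ K : ℝ, ∀ᵐ x ∂μ, ‖x‖ ≤ K := by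
  set A := (realMatrix R)⁻¹ with hA
  have hsum : Summable fun n : ℕ => ‖A ^ n‖ := hR.summable_norm_inv_pow
  set β : ℝ := ∑ b ∈ B, ‖toReal b‖ with hβ
  have hβ0 : 0 ≤ β := Finset.sum_nonneg fun _ _ => norm_nonneg _
  have hβb : ∀ b ∈ B, ‖toReal b‖ ≤ β := fun b hb =>
    Finset.single_le_sum (f := fun b => ‖toReal b‖) (fun _ _ => norm_nonneg _) hb
  set s : ℕ → ℝ := fun n => ∑ k ∈ Finset.range n, ‖A ^ (k + 1)‖ * β with hs
  have hsum' : Summable fun k : ℕ => ‖A ^ (k + 1)‖ * β :=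
    ((summable_nat_add_iff 1).mpr hsum).mul_right β
  -- The extra `1` leaves room for the term `‖A ^ n *ᵥ y‖`, which drops below `1` for large `n`.
  set K : ℝ := (∑' k : ℕ, ‖A ^ (k + 1)‖ * β) + 1 with hK
  have hsK : ∀ n, s n + 1 ≤ K := fun n => by
    have := hsum'.sum_le_tsum (Finset.range n) (fun k _ => by positivity)
    simp only [hs, hK]
    linarith
  -- Every `n`-fold composition of the `τ_b` sends a point of `G n` into the ball of radius `K`, `s
  -- n` bounding the contribution of the digits. Each `τ_b` maps `G (n + 1)` into `G n`, so by
  -- invariance `μ (G n)` is nonincreasing in `n`.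
  let G : ℕ → Set (Fin d → ℝ) := fun n => {y | ‖A ^ n *ᵥ y‖ + s n ≤ K}
  have hGm : ∀ n, MeasurableSet (G n) := fun n => by
    refine (isClosed_le ?_ continuous_const).measurableSet
    exact ((continuous_const.matrix_mulVec continuous_id).norm).add continuous_const
  have hstep : ∀ n, μ (G (n + 1)) ≤ μ (G n) := by
    intro n
    have hN : (B.card : ℝ≥0∞) ≠ 0 := by exact_mod_cast hμ.nonempty.card_ne_zero
    have hsub : ∀ b ∈ B, G (n + 1) ⊆ tau R b ⁻¹' G n := by
      intro b hb y hy
      simp only [G, Set.mem_ofPred_eq, Set.mem_preimage] at hy ⊢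
      have h1 : A ^ n *ᵥ tau R b y = A ^ (n + 1) *ᵥ y + A ^ (n + 1) *ᵥ toReal b := by
        rw [tau, Matrix.mulVec_mulVec, ← hA, ← pow_succ, Matrix.mulVec_add]
      have h2 : ‖A ^ (n + 1) *ᵥ toReal b‖ ≤ ‖A ^ (n + 1)‖ * β :=
        (Matrix.linfty_opNorm_mulVec _ _).trans
          (mul_le_mul_of_nonneg_left (hβb b hb) (norm_nonneg _))
      have h3 : s (n + 1) = s n + ‖A ^ (n + 1)‖ * β := Finset.sum_range_succ _ _
      rw [h1]
      have h4 := norm_add_le (A ^ (n + 1) *ᵥ y) (A ^ (n + 1) *ᵥ toReal b)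
      linarith
    calc μ (G (n + 1)) = (B.card : ℝ≥0∞)⁻¹ * ∑ _b ∈ B, μ (G (n + 1)) := by
          rw [Finset.sum_const, nsmul_eq_mul, ← mul_assoc,
            ENNReal.inv_mul_cancel hN (ENNReal.natCast_ne_top _), one_mul]
      _ ≤ (B.card : ℝ≥0∞)⁻¹ * ∑ b ∈ B, μ (tau R b ⁻¹' G n) := by
          gcongr with b hb
          exact hsub b hb
      _ = μ (G n) := (hμ _ (hGm n)).symm
  have hG0 : ∀ n, μ (G n) ≤ μ (G 0) := fun n => by
    induction n with
    | zero => exact le_rfl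
    | succ n ih => exact (hstep n).trans ih
  -- Since `A ^ n → 0`, any fixed ball lies in `G n` for some `n`; hence `G 0`, the ball of radius
  -- `K`, has full measure.
  have hball : ∀ m : ℕ, μ (Metric.closedBall 0 m) ≤ μ (G 0) := by
    intro m
    have ht : Tendsto (fun n => ‖A ^ n‖ * m) atTop (𝓝 (0 * m)) :=
      hsum.tendsto_atTop_zero.mul_const _
    rw [zero_mul] at ht
    obtain ⟨n, hn⟩ := (ht.eventually (gt_mem_nhds one_pos)).exists
    refine (measure_mono fun y hy => ?_).trans (hG0 n)
    rw [mem_closedBall_zero_iff] at hy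
    have h1 : ‖A ^ n *ᵥ y‖ ≤ ‖A ^ n‖ * m :=
      (Matrix.linfty_opNorm_mulVec _ _).trans (mul_le_mul_of_nonneg_left hy (norm_nonneg _))
    have := hsK n
    simp only [G, Set.mem_ofPred_eq]
    linarith
  have hfull : μ (G 0) = 1 := by
    refine le_antisymm prob_le_one ?_
    have hmono : Monotone fun m : ℕ => Metric.closedBall (0 : Fin d → ℝ) (m : ℝ) :=
      fun a b hab => Metric.closedBall_subset_closedBall (by exact_mod_cast hab)
    have ht := tendsto_measure_iUnion_atTop (μ := μ) hmono
    rw [Metric.iUnion_closedBall_nat, measure_univ] at ht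
    exact le_of_tendsto' ht hball
  refine ⟨K, ?_⟩
  have : ∀ᵐ x ∂μ, x ∈ G 0 := (prob_compl_eq_zero_iff (hGm 0)).mpr hfull
  filter_upwards [this] with x hx
  simpa [G, hs] using hx

end BoundedSupport

/-! ### Exponentials and their inner products. -/

section Exponentials

variable {d : ℕ}

theorem expo_add_left (s t x : Fin d → ℝ) : expo (s + t) x = expo s x * expo t x := by
  rw [expo, expo, expo, ← Complex.exp_add, add_dotProduct]
  push_cast
  ring_nf

theorem expo_add_right (t x y : Fin d → ℝ) : expo t (x + y) = expo t x * expo t y := by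
  rw [expo, expo, expo, ← Complex.exp_add, dotProduct_add]
  push_cast
  ring_nf

theorem conj_expo (t x : Fin d → ℝ) : conj (expo t x) = expo (-t) x := by
  rw [expo, expo, ← Complex.exp_conj]
  congr 1
  simp only [map_mul, map_ofNat, Complex.conj_ofReal, Complex.conj_I, neg_dotProduct,
    Complex.ofReal_neg]
  ring

theorem expo_mulVec (M : Matrix (Fin d) (Fin d) ℝ) (t x : Fin d → ℝ) :
    expo t (M *ᵥ x) = expo (Mᵀ *ᵥ t) x := by
  rw [expo, expo, Matrix.dotProduct_mulVec, Matrix.mulVec_transpose]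

theorem expo_comm (t x : Fin d → ℝ) : expo t x = expo x t := by
  rw [expo, expo, dotProduct_comm]

theorem expo_toReal_toReal (s b : Fin d → ℤ) : expo (toReal s) (toReal b) = 1 := by
  have : toReal s ⬝ᵥ toReal b = ((s ⬝ᵥ b : ℤ) : ℝ) := by
    simp [toReal, dotProduct]
  rw [expo, this, Complex.exp_eq_one_iff]
  exact ⟨s ⬝ᵥ b, by push_cast; ring⟩

theorem toReal_add (s t : Fin d → ℤ) : toReal (s + t) = toReal s + toReal t := by
  ext i
  simp [toReal]

theorem toReal_zero : toReal (0 : Fin d → ℤ) = 0 := by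
  ext i
  simp [toReal]

theorem toReal_mulVec (M : Matrix (Fin d) (Fin d) ℤ) (s : Fin d → ℤ) :
    toReal (M *ᵥ s) = realMatrix M *ᵥ toReal s := by
  ext i
  simp [toReal, realMatrix, Matrix.mulVec, dotProduct]

theorem realMatrix_transpose (R : Matrix (Fin d) (Fin d) ℤ) :
    realMatrix Rᵀ = (realMatrix R)ᵀ := rfl

theorem norm_expoLp (μ : Measure (Fin d → ℝ)) [IsProbabilityMeasure μ] (t : Fin d → ℝ) :
    ‖expoLp μ t‖ = 1 := by
  rw [expoLp, Lp.norm_toLp, eLpNorm_congr_norm_ae (g := fun _ => (1 : ℂ))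
    (Eventually.of_forall fun x => by simp [norm_expo])]
  simp [eLpNorm_const _ two_ne_zero (IsProbabilityMeasure.ne_zero μ)]

theorem coeFn_expoLp (μ : Measure (Fin d → ℝ)) [IsFiniteMeasure μ] (t : Fin d → ℝ) :
    expoLp μ t =ᵐ[μ] expo t := (memLp_expo μ t).coeFn_toLp

theorem inner_expoLp (μ : Measure (Fin d → ℝ)) [IsFiniteMeasure μ] (t : Fin d → ℝ)
    (f : Lp ℂ 2 μ) : inner ℂ (expoLp μ t) f = ∫ x, conj (expo t x) * f x ∂μ := by
  rw [L2.inner_def]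
  refine integral_congr_ae ?_
  filter_upwards [coeFn_expoLp μ t] with x hx
  rw [hx, RCLike.inner_apply, mul_comm]

theorem integrable_conj_expo_mul (μ : Measure (Fin d → ℝ)) [IsFiniteMeasure μ] (t : Fin d → ℝ)
    {f : (Fin d → ℝ) → ℂ} (hf : Integrable f μ) :
    Integrable (fun x => conj (expo t x) * f x) μ :=
  hf.bdd_mul (c := 1)
    ((Complex.continuous_conj.comp (continuous_expo t)).aestronglyMeasurable)
    (Eventually.of_forall fun x => by simp [norm_expo])

end Exponentials

/-! ### The branch operators and their action on exponentials. -/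

section BranchOperators

variable {d : ℕ} {R : Matrix (Fin d) (Fin d) ℤ} {B : Finset (Fin d → ℤ)}
  {μ : Measure (Fin d → ℝ)} [IsProbabilityMeasure μ]

/-- The function `x ↦ N⁻¹ ∑_b conj (a e_l(τ_b x)) f(τ_b x)`. -/
def branchFun (R : Matrix (Fin d) (Fin d) ℤ) (B : Finset (Fin d → ℤ)) (l : Fin d → ℤ) (a : ℂ)
    (f : (Fin d → ℝ) → ℂ) (x : Fin d → ℝ) : ℂ :=
  (B.card : ℂ)⁻¹ * ∑ b ∈ B, conj (a * expo (toReal l) (tau R b x)) * f (tau R b x)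

theorem IsSelfAffineMeasure.memLp_branchFun (hμ : IsSelfAffineMeasure R B μ) (l : Fin d → ℤ)
    (a : ℂ) {f : (Fin d → ℝ) → ℂ} (hf : MemLp f 2 μ) : MemLp (branchFun R B l a f) 2 μ := by
  have hg : MemLp (fun y => conj (a * expo (toReal l) y) * f y) 2 μ := by
    refine hf.of_le_mul (c := ‖a‖) ?_ ?_
    · exact ((Complex.continuous_conj.comp
        (continuous_const.mul (continuous_expo _))).aestronglyMeasurable).mul hf.1
    · exact Eventually.of_forall fun x => by simp [norm_expo]
  have hsum : MemLp (fun x => ∑ b ∈ B, conj (a * expo (toReal l) (tau R b x)) * f (tau R b x))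
      2 μ := memLp_finsetSum B fun b hb => hμ.memLp_comp_tau hb hg
  exact hsum.const_mul _

/-- The adjoint of the weighted isometry `f ↦ a e_l · f ∘ 𝓡`, where `𝓡` is the common left
inverse of the maps `τ_b`. -/
def branch (hμ : IsSelfAffineMeasure R B μ) (l : Fin d → ℤ) (a : ℂ) (f : Lp ℂ 2 μ) : Lp ℂ 2 μ :=
  (hμ.memLp_branchFun l a (Lp.memLp f)).toLp (branchFun R B l a f)

theorem coeFn_branch (hμ : IsSelfAffineMeasure R B μ) (l : Fin d → ℤ) (a : ℂ) (f : Lp ℂ 2 μ) :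
    branch hμ l a f =ᵐ[μ] branchFun R B l a f := MemLp.coeFn_toLp _

/-- Integrality gives `e_s(b) = 1`, so `e_{Rᵀs} ∘ τ_b = e_s` for every `b`. The factor `e_s`
therefore moves inside the average over `b`, which invariance turns into one integral against `μ`.
-/
theorem inner_expoLp_branch (hR : IsExpansive R) (hμ : IsSelfAffineMeasure R B μ)
    (l : Fin d → ℤ) (a : ℂ) (s : Fin d → ℤ) (f : Lp ℂ 2 μ) :
    inner ℂ (expoLp μ (toReal s)) (branch hμ l a f) =
      inner ℂ (a • expoLp μ (toReal (l + Rᵀ *ᵥ s))) f := by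
  have hf : Integrable f μ := (Lp.memLp f).integrable one_le_two
  have hF := integrable_conj_expo_mul μ (toReal (l + Rᵀ *ᵥ s)) hf
  have hper : ∀ b x, expo (toReal (Rᵀ *ᵥ s)) (tau R b x) = expo (toReal s) x := by
    intro b x
    rw [toReal_mulVec, realMatrix_transpose, ← expo_mulVec, tau, Matrix.mulVec_mulVec,
      Matrix.mul_nonsing_inv _ hR.isUnit_det, Matrix.one_mulVec, expo_add_right,
      expo_toReal_toReal, mul_one]
  rw [inner_smul_left, inner_expoLp, inner_expoLp, hμ.integral_eq hF, mul_left_comm,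
    Finset.mul_sum]
  have h1 : ∫ x, conj (expo (toReal s) x) * branch hμ l a f x ∂μ =
      ∫ x, (B.card : ℂ)⁻¹ * ∑ b ∈ B, conj a * (conj (expo (toReal (l + Rᵀ *ᵥ s)) (tau R b x)) *
        f (tau R b x)) ∂μ := by
    refine integral_congr_ae ?_
    filter_upwards [coeFn_branch hμ l a f] with x hx
    rw [hx, branchFun, mul_left_comm, Finset.mul_sum]
    congr 1
    refine Finset.sum_congr rfl fun b _ => ?_
    rw [toReal_add, expo_add_left, hper, map_mul, map_mul]
    ring
  rw [h1, integral_const_mul, integral_finsetSum]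
  · simp only [integral_const_mul]
  · intro b hb
    refine Integrable.const_mul ?_ _
    exact memLp_one_iff_integrable.mp
      (hμ.memLp_comp_tau hb (memLp_one_iff_integrable.mpr hF))

/-- Here the transfer operator appears: `e_{t-l}(τ_b x) = e_{g_l t}(b) e_{g_l t}(x)`, and averaging
the first factor over `b` produces the mask. -/
theorem branch_expoLp (hμ : IsSelfAffineMeasure R B μ)
    (l : Fin d → ℤ) (a : ℂ) (t : Fin d → ℝ) :
    branch hμ l a (expoLp μ t) =
      (conj a * mask B (dualMap R l t)) • expoLp μ (dualMap R l t) := by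
  refine Lp.ext ?_
  have hq : ∀ᵐ x ∂μ, ∀ b ∈ B, expoLp μ t (tau R b x) = expo t (tau R b x) := by
    rw [Finset.eventually_all]
    exact fun b hb => (hμ.quasiMeasurePreserving hb).ae (coeFn_expoLp μ t)
  filter_upwards [coeFn_branch hμ l a (expoLp μ t), Lp.coeFn_smul
    (conj a * mask B (dualMap R l t)) (expoLp μ (dualMap R l t)),
    coeFn_expoLp μ (dualMap R l t), hq] with x h1 h2 h3 h4
  rw [h1, h2, Pi.smul_apply, h3, smul_eq_mul, branchFun, mask]
  simp only [Finset.mul_sum, Finset.sum_mul]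
  refine Finset.sum_congr rfl fun b hb => ?_
  have h5 : conj (expo (toReal l) (tau R b x)) * expo t (tau R b x) =
      expo (toReal b) (dualMap R l t) * expo (dualMap R l t) x := by
    rw [conj_expo, ← expo_add_left, tau, expo_mulVec, expo_add_right, expo_comm (toReal b),
      mul_comm, dualMap, Matrix.transpose_nonsing_inv, sub_eq_neg_add]
  rw [h4 b hb, map_mul, mul_assoc (conj a), h5]
  ring

end BranchOperators

/-! ### The isometry of `T` as a Parseval identity for the branches. -/

section ParsevalIdentity

variable {d : ℕ} {R : Matrix (Fin d) (Fin d) ℤ} {B L : Finset (Fin d → ℤ)} {α : L → ℂ}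

theorem star_dotProduct_self {k : Type*} [Fintype k] (v : k → ℂ) :
    star v ⬝ᵥ v = ((∑ i, ‖v i‖ ^ 2 : ℝ) : ℂ) := by
  push_cast
  exact Finset.sum_congr rfl fun i _ => by simp [Complex.conj_mul']

theorem sum_norm_sq_mulVec_of_isometry {m n : Type*} [Fintype m] [Fintype n] [DecidableEq n]
    {T : Matrix m n ℂ} (hT : Tᴴ * T = 1) (u : n → ℂ) :
    ∑ i, ‖(T *ᵥ u) i‖ ^ 2 = ∑ j, ‖u j‖ ^ 2 := by
  have h : star (T *ᵥ u) ⬝ᵥ (T *ᵥ u) = star u ⬝ᵥ u := by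
    rw [Matrix.star_mulVec, ← Matrix.dotProduct_mulVec, Matrix.mulVec_mulVec, hT,
      Matrix.one_mulVec]
  rw [star_dotProduct_self, star_dotProduct_self] at h
  exact_mod_cast h

/-- For fixed `x`, the values over `l` are `N^{-1/2}` times unimodular factors times the conjugates
of the entries of `T u`, where `u_b = conj f(τ_b x)`. The conjugate enters because the branches
carry `conj α_l` and `conj e_l`, while `T` does not. -/
theorem sum_norm_sq_branchFun (hB : B.Nonempty)
    (hT : (weightMatrix R B L α)ᴴ * weightMatrix R B L α = 1)
    (f : (Fin d → ℝ) → ℂ) (x : Fin d → ℝ) :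
    ∑ l : L, ‖branchFun R B l.1 (α l) f x‖ ^ 2 =
      (B.card : ℝ)⁻¹ * ∑ b ∈ B, ‖f (tau R b x)‖ ^ 2 := by
  have hN : (0 : ℝ) < B.card := by exact_mod_cast hB.card_pos
  have h := sum_norm_sq_mulVec_of_isometry hT (fun b : B => conj (f (tau R b.1 x)))
  have hrow : ∀ l : L, ‖branchFun R B l.1 (α l) f x‖ ^ 2 =
      (B.card : ℝ)⁻¹ *
        ‖(weightMatrix R B L α *ᵥ fun b : B => conj (f (tau R b.1 x))) l‖ ^ 2 := by
    intro l
    have h1 : branchFun R B l.1 (α l) f x =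
        ((Real.sqrt (B.card : ℝ) : ℝ) : ℂ)⁻¹ *
          (conj (expo (((realMatrix R)ᵀ)⁻¹ *ᵥ toReal l.1) x) *
          conj ((weightMatrix R B L α *ᵥ fun b : B => conj (f (tau R b.1 x))) l)) := by
      have h2 : (B.card : ℂ)⁻¹ = ((Real.sqrt (B.card : ℝ) : ℝ) : ℂ)⁻¹ *
          ((Real.sqrt (B.card : ℝ) : ℝ) : ℂ)⁻¹ := by
        rw [← mul_inv, ← Complex.ofReal_mul, Real.mul_self_sqrt hN.le, Complex.ofReal_natCast]
      rw [branchFun, ← Finset.sum_coe_sort B, h2, mul_assoc]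
      congr 1
      rw [Matrix.mulVec, dotProduct, map_sum, Finset.mul_sum, Finset.mul_sum]
      refine Finset.sum_congr rfl fun b _ => ?_
      simp only [weightMatrix, Matrix.of_apply, map_mul, Complex.conj_conj, map_inv₀,
        Complex.conj_ofReal]
      rw [tau, expo_mulVec, expo_add_right, Matrix.transpose_nonsing_inv, map_mul]
      ring
    rw [h1, norm_mul, norm_mul, RCLike.norm_conj, RCLike.norm_conj, norm_expo, one_mul,
      mul_pow, norm_inv, Complex.norm_real, Real.norm_eq_abs, inv_pow, sq_abs,
      Real.sq_sqrt hN.le]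
  simp_rw [hrow]
  rw [← Finset.mul_sum, h, ← Finset.sum_coe_sort B]
  simp

theorem enorm_sq_eq_lintegral {μ : Measure (Fin d → ℝ)} (f : Lp ℂ 2 μ) : ‖f‖ₑ ^ 2 = ∫⁻ x, ‖f x‖ₑ ^ 2 ∂μ := by
  rw [Lp.enorm_def, eLpNorm_eq_lintegral_rpow_enorm_toReal two_ne_zero ENNReal.ofNat_ne_top]
  simp only [ENNReal.toReal_ofNat, ENNReal.rpow_ofNat]
  rw [← ENNReal.rpow_ofNat, ← ENNReal.rpow_mul]
  norm_num

/-- Integrating the pointwise identity leaves the average of `∫ |f ∘ τ_b|²` over `b`, which is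
`‖f‖²` by invariance. -/
theorem sum_enorm_sq_branch {μ : Measure (Fin d → ℝ)} [IsProbabilityMeasure μ]
    (hμ : IsSelfAffineMeasure R B μ)
    (hT : (weightMatrix R B L α)ᴴ * weightMatrix R B L α = 1) (f : Lp ℂ 2 μ) :
    ∑ l : L, ‖branch hμ l.1 (α l) f‖ₑ ^ 2 = ‖f‖ₑ ^ 2 := by
  have hm : AEMeasurable (fun x => ‖f x‖ₑ ^ 2) μ :=
    (Lp.aestronglyMeasurable f).enorm.pow_const 2
  have hN : (0 : ℝ) < B.card := by exact_mod_cast hμ.nonempty.card_pos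
  have hpt : ∀ x, ∑ l : L, ‖branchFun R B l.1 (α l) f x‖ₑ ^ 2 =
      (B.card : ℝ≥0∞)⁻¹ * ∑ b ∈ B, ‖f (tau R b x)‖ₑ ^ 2 := by
    intro x
    have h := congrArg ENNReal.ofReal (sum_norm_sq_branchFun hμ.nonempty hT f x)
    rw [ENNReal.ofReal_mul (by positivity), ENNReal.ofReal_sum_of_nonneg (fun _ _ => by positivity),
      ENNReal.ofReal_sum_of_nonneg (fun _ _ => by positivity), ENNReal.ofReal_inv_of_pos hN,
      ENNReal.ofReal_natCast] at h
    simpa only [ENNReal.ofReal_pow (norm_nonneg _), ofReal_norm] using h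
  have hb : ∀ l : L, ‖branch hμ l.1 (α l) f‖ₑ ^ 2 =
      ∫⁻ x, ‖branchFun R B l.1 (α l) f x‖ₑ ^ 2 ∂μ := fun l => by
    rw [enorm_sq_eq_lintegral]
    refine lintegral_congr_ae ?_
    filter_upwards [coeFn_branch hμ l.1 (α l) f] with x hx
    rw [hx]
  simp_rw [hb]
  rw [← lintegral_finsetSum']
  · simp_rw [hpt]
    rw [lintegral_const_mul'' , lintegral_finsetSum', enorm_sq_eq_lintegral, hμ.lintegral_eq hm]
    · exact fun b hb => hm.comp_quasiMeasurePreserving (hμ.quasiMeasurePreserving hb)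
    · exact Finset.aemeasurable_fun_sum _ fun b hb =>
        hm.comp_quasiMeasurePreserving (hμ.quasiMeasurePreserving hb)
  · exact fun l _ => (hμ.memLp_branchFun l.1 (α l) (Lp.memLp f)).1.enorm.pow_const 2

end ParsevalIdentity

/-! ### Self-similarity of the set of words. -/

section WordRecursion

variable {d : ℕ} {L : Finset (Fin d → ℤ)}

theorem frequency_nil (R : Matrix (Fin d) (Fin d) ℤ) : frequency R ([] : List L) = 0 := by
  simp [frequency]

theorem frequency_cons (R : Matrix (Fin d) (Fin d) ℤ) (l : L) (w : List L) :
    frequency R (l :: w) = l.1 + Rᵀ *ᵥ frequency R w := by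
  unfold frequency
  rw [show (∑ i : Fin (l :: w).length, Rᵀ ^ (i : ℕ) *ᵥ ((l :: w).get i).1) =
    ∑ i : Fin (w.length + 1), Rᵀ ^ (i : ℕ) *ᵥ ((l :: w).get i).1 from rfl, Fin.sum_univ_succ]
  simp only [Fin.val_zero, pow_zero, Matrix.one_mulVec, Fin.val_succ, pow_succ']
  rw [← Matrix.mulVecLin_apply Rᵀ, map_sum]
  simp only [Matrix.mulVecLin_apply, Matrix.mulVec_mulVec]
  rfl

/-- The weighted exponential of an arbitrary word. -/
def listExpo (R : Matrix (Fin d) (Fin d) ℤ) (α : L → ℂ) (μ : Measure (Fin d → ℝ))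
    [IsFiniteMeasure μ] (w : List L) : Lp ℂ 2 μ :=
  (w.map α).prod • expoLp μ (toReal (frequency R w))

/-- Prepending a digit to a word of `Ω(L)`, with `0` prepended to the empty word giving the
empty word. -/
def consWord (p : L × Words L) : Words L :=
  if h : p.1.1 = 0 ∧ p.2.1 = [] then p.2
  else ⟨p.1 :: p.2.1, fun _ => by
    by_cases hw : p.2.1 = []
    · simpa [hw] using fun h0 => h ⟨h0, hw⟩
    · rw [List.getLast_cons hw]
      exact p.2.2 hw⟩

theorem consWord_val_of_ne {p : L × Words L} (h : ¬(p.1.1 = 0 ∧ p.2.1 = [])) :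
    (consWord p).1 = p.1 :: p.2.1 :=
  congrArg Subtype.val (dif_neg h)

theorem consWord_of_eq {p : L × Words L} (h : p.1.1 = 0 ∧ p.2.1 = []) :
    consWord p = p.2 :=
  dif_pos h

theorem consWord_injective : Function.Injective (consWord (L := L)) := by
  intro p q hpq
  by_cases hp : p.1.1 = 0 ∧ p.2.1 = [] <;> by_cases hq : q.1.1 = 0 ∧ q.2.1 = []
  · exact Prod.ext (Subtype.ext (hp.1.trans hq.1.symm)) (Subtype.ext (hp.2.trans hq.2.symm))
  · have h := congrArg Subtype.val hpq
    rw [consWord_of_eq hp, consWord_val_of_ne hq, hp.2] at h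
    simp at h
  · have h := congrArg Subtype.val hpq
    rw [consWord_of_eq hq, consWord_val_of_ne hp, hq.2] at h
    simp at h
  · have h := congrArg Subtype.val hpq
    rw [consWord_val_of_ne hp, consWord_val_of_ne hq] at h
    obtain ⟨h1, h2⟩ := List.cons.inj h
    exact Prod.ext h1 (Subtype.ext h2)

theorem consWord_surjective (hL : (0 : Fin d → ℤ) ∈ L) :
    Function.Surjective (consWord (L := L)) := by
  rintro ⟨w, hw⟩
  cases w with
  | nil => exact ⟨(⟨0, hL⟩, ⟨[], hw⟩), consWord_of_eq ⟨rfl, rfl⟩⟩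
  | cons l w =>
    have hw' : ∀ h : w ≠ [], (w.getLast h).1 ≠ 0 := fun h => by
      have := hw (List.cons_ne_nil _ _)
      rwa [List.getLast_cons h] at this
    refine ⟨(l, ⟨w, hw'⟩), Subtype.ext (consWord_val_of_ne ?_)⟩
    rintro ⟨h1, h2⟩
    dsimp only at h1 h2
    subst h2
    exact hw (List.cons_ne_nil _ _) h1

/-- This lets every sum over `Ω(L)` split according to the prepended digit. The word `0` is not in
`Ω(L)`, and `∅` has no first digit: the convention `0∅ = ∅` pairs these two exceptions. -/
theorem consWord_bijective (hL : (0 : Fin d → ℤ) ∈ L) :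
    Function.Bijective (consWord (L := L)) :=
  ⟨consWord_injective, consWord_surjective hL⟩

/-- Stated with inequalities because `0∅ = ∅` does not gain a letter; both sides then hold. -/
theorem length_consWord_le_succ_iff (p : L × Words L) (n : ℕ) :
    (consWord p).1.length ≤ n + 1 ↔ p.2.1.length ≤ n := by
  by_cases hp : p.1.1 = 0 ∧ p.2.1 = []
  · rw [consWord_of_eq hp, hp.2]
    simp
  · rw [consWord_val_of_ne hp]
    simp

variable {R : Matrix (Fin d) (Fin d) ℤ} {B : Finset (Fin d → ℤ)} {α : L → ℂ}
  {μ : Measure (Fin d → ℝ)} [IsProbabilityMeasure μ]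

theorem inner_listExpo_branch (hR : IsExpansive R) (hμ : IsSelfAffineMeasure R B μ)
    (l : L) (w : List L) (f : Lp ℂ 2 μ) :
    inner ℂ (listExpo R α μ w) (branch hμ l.1 (α l) f) = inner ℂ (listExpo R α μ (l :: w)) f := by
  rw [listExpo, listExpo, frequency_cons, inner_smul_left, inner_expoLp_branch hR,
    inner_smul_left, inner_smul_left, List.map_cons, List.prod_cons, map_mul]
  ring

/-- In the exceptional case the words `0` and `∅` have the same frequency, and the same weight
because `α_0 = 1`. -/
theorem inner_weightedExpo_consWord (hR : IsExpansive R) (hμ : IsSelfAffineMeasure R B μ)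
    {hL : (0 : Fin d → ℤ) ∈ L} (hα : α ⟨0, hL⟩ = 1) (p : L × Words L) (f : Lp ℂ 2 μ) :
    inner ℂ (weightedExpo R α μ (consWord p)) f =
      inner ℂ (weightedExpo R α μ p.2) (branch hμ p.1.1 (α p.1) f) := by
  have h : weightedExpo R α μ (consWord p) = listExpo R α μ (p.1 :: p.2.1) := by
    by_cases hp : p.1.1 = 0 ∧ p.2.1 = []
    · have h0 : p.1 = ⟨0, hL⟩ := Subtype.ext hp.1
      rw [consWord_of_eq hp, weightedExpo, listExpo, hp.2, h0, frequency_cons, frequency_nil]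
      simp [hα]
    · rw [weightedExpo, listExpo, consWord_val_of_ne hp]
  rw [h, ← inner_listExpo_branch hR hμ]
  rfl

end WordRecursion

/-! ### The recursion for the frame sum and the Bessel bound. -/

section Bessel

variable {d : ℕ} {R : Matrix (Fin d) (Fin d) ℤ} {B L : Finset (Fin d → ℤ)} {α : L → ℂ}
  {μ : Measure (Fin d → ℝ)} [IsProbabilityMeasure μ]

theorem tsum_enorm_sq_inner_weightedExpo_eq_sum_branch (hR : IsExpansive R)
    (hμ : IsSelfAffineMeasure R B μ) (hL : (0 : Fin d → ℤ) ∈ L) (hα : α ⟨0, hL⟩ = 1)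
    (f : Lp ℂ 2 μ) :
    ∑' w, ‖inner ℂ (weightedExpo R α μ w) f‖ₑ ^ 2 =
      ∑ l : L, ∑' w, ‖inner ℂ (weightedExpo R α μ w) (branch hμ l.1 (α l) f)‖ₑ ^ 2 := by
  rw [← (Equiv.ofBijective _ (consWord_bijective hL)).tsum_eq,
    ENNReal.tsum_prod', tsum_fintype]
  simp only [Equiv.ofBijective_apply, inner_weightedExpo_consWord hR hμ hα]

/-- The full recursion alone bounds nothing, but cutting off by length makes it an induction. Only
the empty word has length `0`, where Cauchy–Schwarz against a unit vector suffices; the Parseval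
identity for the branches carries the step. -/
theorem tsum_length_le_enorm_sq_inner_le (hR : IsExpansive R)
    (hμ : IsSelfAffineMeasure R B μ) (hL : (0 : Fin d → ℤ) ∈ L) (hα : α ⟨0, hL⟩ = 1)
    (hT : (weightMatrix R B L α)ᴴ * weightMatrix R B L α = 1) (n : ℕ) (f : Lp ℂ 2 μ) :
    ∑' w : Words L, (if w.1.length ≤ n then ‖inner ℂ (weightedExpo R α μ w) f‖ₑ ^ 2 else 0) ≤
      ‖f‖ₑ ^ 2 := by
  induction n generalizing f with
  | zero =>
    let e : Words L := ⟨[], fun h => absurd rfl h⟩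
    rw [tsum_eq_single e]
    · have h1 : weightedExpo R α μ e = expoLp μ 0 := by
        simp [weightedExpo, e, frequency_nil, toReal_zero]
      rw [if_pos (by simp [e]), h1]
      have h2 := norm_inner_le_norm (𝕜 := ℂ) (expoLp μ 0) f
      rw [norm_expoLp, one_mul] at h2
      gcongr
      exact enorm_le_iff_norm_le.mpr h2
    · intro w hw
      refine if_neg fun h => hw (Subtype.ext ?_)
      exact List.length_eq_zero_iff.mp (Nat.le_zero.mp h)
  | succ n ih =>
    rw [← (Equiv.ofBijective _ (consWord_bijective hL)).tsum_eq,
      ENNReal.tsum_prod', tsum_fintype]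
    simp only [Equiv.ofBijective_apply, inner_weightedExpo_consWord hR hμ hα,
      length_consWord_le_succ_iff]
    rw [← sum_enorm_sq_branch hμ hT f]
    exact Finset.sum_le_sum fun l _ => ih _

theorem sum_norm_sq_inner_weightedExpo_le (hR : IsExpansive R)
    (hμ : IsSelfAffineMeasure R B μ) (hL : (0 : Fin d → ℤ) ∈ L) (hα : α ⟨0, hL⟩ = 1)
    (hT : (weightMatrix R B L α)ᴴ * weightMatrix R B L α = 1) (f : Lp ℂ 2 μ)
    (s : Finset (Words L)) :
    ∑ w ∈ s, ‖inner ℂ (weightedExpo R α μ w) f‖ ^ 2 ≤ ‖f‖ ^ 2 := by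
  have h : ∑ w ∈ s, ‖inner ℂ (weightedExpo R α μ w) f‖ₑ ^ 2 ≤ ‖f‖ₑ ^ 2 := by
    refine le_trans ?_ (tsum_length_le_enorm_sq_inner_le hR hμ hL hα hT
      (s.sup fun w => w.1.length) f)
    refine le_trans (Finset.sum_le_sum fun w hw => ?_) (ENNReal.sum_le_tsum s)
    rw [if_pos (Finset.le_sup (f := fun w : Words L => w.1.length) hw)]
  simp only [← ofReal_norm, ← ENNReal.ofReal_pow (norm_nonneg _)] at h
  rwa [← ENNReal.ofReal_sum_of_nonneg (fun _ _ => by positivity),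
    ENNReal.ofReal_le_ofReal_iff (by positivity)] at h

end Bessel

/-! ### Analysis operators and a rigidity property of contractions. -/

section AnalysisOperator

variable {ι H : Type*} [NormedAddCommGroup H] [InnerProductSpace ℂ H]

theorem summable_of_bessel {e : ι → H}
    (he : ∀ (v : H) (s : Finset ι), ∑ i ∈ s, ‖inner ℂ (e i) v‖ ^ 2 ≤ ‖v‖ ^ 2) (v : H) :
    Summable fun i => ‖inner ℂ (e i) v‖ ^ 2 :=
  summable_of_sum_le (fun _ => by positivity) (he v)

theorem memℓp_inner_of_bessel {e : ι → H}
    (he : ∀ (v : H) (s : Finset ι), ∑ i ∈ s, ‖inner ℂ (e i) v‖ ^ 2 ≤ ‖v‖ ^ 2) (v : H) :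
    Memℓp (fun i => inner ℂ (e i) v) 2 :=
  memℓp_gen (by simpa using summable_of_bessel he v)

/-- The analysis operator of a Bessel family with bound one. -/
def analysisOp (e : ι → H)
    (he : ∀ (v : H) (s : Finset ι), ∑ i ∈ s, ‖inner ℂ (e i) v‖ ^ 2 ≤ ‖v‖ ^ 2) :
    H →L[ℂ] lp (fun _ : ι => ℂ) 2 :=
  LinearMap.mkContinuous
    { toFun := fun v => ⟨fun i => inner ℂ (e i) v, memℓp_inner_of_bessel he v⟩
      map_add' := fun u v => Subtype.ext (funext fun i => inner_add_right _ _ _)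
      map_smul' := fun c v => Subtype.ext (funext fun i => inner_smul_right _ _ _) } 1
    (fun v => by
      rw [one_mul]
      refine lp.norm_le_of_forall_sum_le (by norm_num) (norm_nonneg _) fun s => ?_
      simpa using he v s)

theorem hasSum_norm_sq_analysisOp {e : ι → H}
    (he : ∀ (v : H) (s : Finset ι), ∑ i ∈ s, ‖inner ℂ (e i) v‖ ^ 2 ≤ ‖v‖ ^ 2) (v : H) :
    HasSum (fun i => ‖inner ℂ (e i) v‖ ^ 2) (‖analysisOp e he v‖ ^ 2) := by
  have h := lp.hasSum_norm (p := 2) (by norm_num) (analysisOp e he v)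
  simp only [ENNReal.toReal_ofNat, Real.rpow_ofNat] at h
  exact h

theorem norm_analysisOp_le {e : ι → H}
    (he : ∀ (v : H) (s : Finset ι), ∑ i ∈ s, ‖inner ℂ (e i) v‖ ^ 2 ≤ ‖v‖ ^ 2) :
    ‖analysisOp e he‖ ≤ 1 :=
  LinearMap.mkContinuous_norm_le _ zero_le_one _

/-- A contraction of Hilbert spaces which preserves the norms of a family with dense span is an
isometry. -/
theorem norm_eq_of_norm_eq_on_total {E F κ : Type*} [NormedAddCommGroup E]
    [InnerProductSpace ℂ E] [CompleteSpace E] [NormedAddCommGroup F] [InnerProductSpace ℂ F]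
    [CompleteSpace F] (Θ : E →L[ℂ] F) (hΘ : ‖Θ‖ ≤ 1) (g : κ → E)
    (hg : ∀ v : E, (∀ k, inner ℂ (g k) v = 0) → v = 0) (hiso : ∀ k, ‖Θ (g k)‖ = ‖g k‖) (v : E) :
    ‖Θ v‖ = ‖v‖ := by
  set P := (ContinuousLinearMap.adjoint Θ).comp Θ with hP
  have hPinner : ∀ u w, inner ℂ u (P w) = inner ℂ (Θ u) (Θ w) := fun u w => by
    rw [hP, ContinuousLinearMap.comp_apply, ContinuousLinearMap.adjoint_inner_right]
  have hPnorm : ∀ u, ‖P u‖ ≤ ‖u‖ := fun u => by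
    have h1 : ‖P‖ ≤ 1 := by
      refine (ContinuousLinearMap.opNorm_comp_le _ _).trans ?_
      rw [LinearIsometryEquiv.norm_map]
      exact mul_le_one₀ hΘ (norm_nonneg _) hΘ
    simpa using P.le_of_opNorm_le h1 u
  -- Equality forces fixed vectors: `‖Pg - g‖² = ‖Pg‖² - 2‖g‖² + ‖g‖² ≤ 0`, using `⟨Pg, g⟩ = ‖Θg‖² =
  -- ‖g‖²`.
  have hfix : ∀ k, P (g k) = g k := fun k => by
    have h1 : RCLike.re (inner ℂ (P (g k)) (g k)) = ‖g k‖ ^ 2 := by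
      rw [inner_re_symm, hPinner, inner_self_eq_norm_sq, hiso]
    have h2 := norm_sub_sq (𝕜 := ℂ) (P (g k)) (g k)
    rw [h1] at h2
    have h3 := pow_le_pow_left₀ (norm_nonneg _) (hPnorm (g k)) 2
    have h4 : ‖P (g k) - g k‖ ^ 2 ≤ 0 := by linarith
    have h5 : ‖P (g k) - g k‖ = 0 := pow_eq_zero_iff two_ne_zero |>.mp
      (le_antisymm h4 (by positivity))
    exact sub_eq_zero.mp (norm_eq_zero.mp h5)
  -- By self-adjointness of `P`, the vector `P v - v` is orthogonal to every fixed vector, so to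
  -- every `g k`.
  have hPv : P v = v := by
    refine sub_eq_zero.mp (hg _ fun k => ?_)
    rw [inner_sub_right, hPinner, ← inner_conj_symm, ← hPinner, hfix, inner_conj_symm, sub_self]
  have h : ‖Θ v‖ ^ 2 = ‖v‖ ^ 2 := by
    rw [← inner_self_eq_norm_sq (𝕜 := ℂ) (Θ v), ← hPinner, hPv, inner_self_eq_norm_sq]
  exact (sq_eq_sq₀ (norm_nonneg _) (norm_nonneg _)).mp h

end AnalysisOperator

/-! ### Totality of the exponentials in `L²(μ)`. -/

section Totality

variable {d : ℕ} {μ : Measure (Fin d → ℝ)}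

theorem integral_withDensity_ofReal {g : (Fin d → ℝ) → ℝ} (hg : Integrable g μ)
    (φ : (Fin d → ℝ) → ℂ) :
    ∫ x, φ x ∂μ.withDensity (fun x => ENNReal.ofReal (g x)) =
      ∫ x, φ x * ((max (g x) 0 : ℝ) : ℂ) ∂μ := by
  rw [integral_withDensity_eq_integral_toReal_smul₀ hg.1.aemeasurable.ennreal_ofReal
    (Eventually.of_forall fun _ => ENNReal.ofReal_lt_top)]
  refine integral_congr_ae (Eventually.of_forall fun x => ?_)
  simp only [ENNReal.toReal_ofReal', Complex.real_smul]
  ring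

/-- An integrable real function whose Fourier transform vanishes is zero. -/
theorem ae_eq_zero_of_integral_expo_mul_ofReal_eq_zero [IsFiniteMeasure μ]
    {g : (Fin d → ℝ) → ℝ} (hg : Integrable g μ)
    (h : ∀ t, ∫ x, expo t x * (g x : ℂ) ∂μ = 0) : g =ᵐ[μ] 0 := by
  have hfin : ∀ {u : (Fin d → ℝ) → ℝ}, Integrable u μ →
      IsFiniteMeasure (μ.withDensity fun x => ENNReal.ofReal (u x)) :=
    fun hu => isFiniteMeasure_withDensity_ofReal hu.2
  have := hfin hg
  have := hfin hg.neg
  have hint : ∀ t {u : (Fin d → ℝ) → ℝ}, Integrable u μ →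
      Integrable (fun x => expo t x * ((max (u x) 0 : ℝ) : ℂ)) μ := fun t u hu =>
    hu.pos_part.ofReal.bdd_mul (c := 1) (continuous_expo t).aestronglyMeasurable
      (Eventually.of_forall fun x => (norm_expo t x).le)
  -- The positive and negative parts of `g` are densities of finite measures with equal
  -- characteristic functions, so the measures coincide.
  have heq : μ.withDensity (fun x => ENNReal.ofReal (g x)) =
      μ.withDensity (fun x => ENNReal.ofReal ((-g) x)) := by
    refine Measure.ext_of_charFunDual (funext fun ℓ => ?_)
    rw [charFunDual_apply, charFunDual_apply]
    -- The frequency for which `ℓ x = 2π t·x`.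
    set t : Fin d → ℝ := fun i => ℓ (Pi.single i 1) / (2 * Real.pi) with ht
    have hexp : ∀ x : Fin d → ℝ, Complex.exp (ℓ x * Complex.I) = expo t x := by
      intro x
      have hx : ℓ x = 2 * Real.pi * (t ⬝ᵥ x) := by
        conv_lhs => rw [pi_eq_sum_univ' x, map_sum]
        rw [dotProduct, Finset.mul_sum]
        refine Finset.sum_congr rfl fun i _ => ?_
        rw [map_smul, smul_eq_mul, ht]
        field_simp
      rw [expo, hx]
      push_cast
      ring_nf
    simp_rw [hexp]
    rw [integral_withDensity_ofReal hg, integral_withDensity_ofReal hg.neg, ← sub_eq_zero,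
      ← integral_sub (hint t hg) (hint t hg.neg), ← h t]
    refine integral_congr_ae (Eventually.of_forall fun x => ?_)
    have h2 : max (g x) 0 - max (-g x) 0 = g x := by
      rcases le_total 0 (g x) with h0 | h0
      · rw [max_eq_left h0, max_eq_right (by linarith), sub_zero]
      · rw [max_eq_right h0, max_eq_left (by linarith), zero_sub, neg_neg]
    simp only [Pi.neg_apply]
    rw [← mul_sub, ← Complex.ofReal_sub, h2]
  rw [withDensity_eq_iff hg.1.aemeasurable.ennreal_ofReal
    hg.neg.1.aemeasurable.ennreal_ofReal hg.lintegral_lt_top.ne] at heq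
  filter_upwards [heq] with x hx
  have h3 := congrArg ENNReal.toReal hx
  rw [ENNReal.toReal_ofReal', ENNReal.toReal_ofReal', Pi.neg_apply] at h3
  rcases le_total 0 (g x) with h0 | h0
  · rw [max_eq_left h0, max_eq_right (by linarith)] at h3
    exact h3
  · rw [max_eq_right h0, max_eq_left (by linarith)] at h3
    simp only [Pi.zero_apply]
    linarith

/-- The Fourier transform of `conj f` at `t` is the conjugate of that of `f` at `-t`. Both vanish,
hence so do those of the real and imaginary parts. -/
theorem eq_zero_of_forall_inner_expoLp_eq_zero [IsFiniteMeasure μ] (f : Lp ℂ 2 μ)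
    (h : ∀ t, inner ℂ (expoLp μ t) f = 0) : f = 0 := by
  have hf : Integrable f μ := (Lp.memLp f).integrable one_le_two
  have hcf : Integrable (fun x => conj (f x)) μ := by
    simpa using (LinearIsometryEquiv.integrable_comp_iff Complex.conjLIE).mpr hf
  have h1 : ∀ t, ∫ x, expo t x * f x ∂μ = 0 := fun t => by
    have := h (-t)
    rw [inner_expoLp] at this
    simpa only [conj_expo, neg_neg] using this
  have h2 : ∀ t, ∫ x, expo t x * conj (f x) ∂μ = 0 := fun t => by
    have h3 := congrArg conj (h1 (-t))
    rw [← integral_conj, map_zero] at h3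
    simpa only [map_mul, conj_expo, neg_neg] using h3
  have hb : ∀ t {u : (Fin d → ℝ) → ℂ}, Integrable u μ → Integrable (fun x => expo t x * u x) μ :=
    fun t u hu => hu.bdd_mul (c := 1) (continuous_expo t).aestronglyMeasurable
      (Eventually.of_forall fun x => (norm_expo t x).le)
  have hre : (fun x => (f x).re) =ᵐ[μ] 0 := by
    refine ae_eq_zero_of_integral_expo_mul_ofReal_eq_zero hf.re fun t => ?_
    have h4 : ∀ x, expo t x * ((f x).re : ℂ) =
        2⁻¹ * (expo t x * f x + expo t x * conj (f x)) := fun x => by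
      rw [Complex.re_eq_add_conj]
      ring
    simp_rw [h4]
    rw [integral_const_mul, integral_add (hb t hf) (hb t hcf), h1, h2, add_zero, mul_zero]
  have him : (fun x => (f x).im) =ᵐ[μ] 0 := by
    refine ae_eq_zero_of_integral_expo_mul_ofReal_eq_zero hf.im fun t => ?_
    have h4 : ∀ x, expo t x * ((f x).im : ℂ) =
        (2 * Complex.I)⁻¹ * (expo t x * f x - expo t x * conj (f x)) := fun x => by
      rw [Complex.im_eq_sub_conj]
      ring
    simp_rw [h4]
    rw [integral_const_mul, integral_sub (hb t hf) (hb t hcf), h1, h2, sub_zero, mul_zero]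
  refine Lp.eq_zero_iff_ae_eq_zero.mpr ?_
  filter_upwards [hre, him] with x h5 h6
  exact Complex.ext h5 h6

end Totality

/-! ### Entire extension in the frequency variable. -/

section EntireExtension

variable {d : ℕ}

/-- The `i`-th coordinate function, truncated to `[-K, K]`. -/
def truncatedCoord (K : ℝ) (i : Fin d) : (Fin d → ℝ) →ᵇ ℂ :=
  BoundedContinuousFunction.ofNormedAddCommGroup
    (fun x => ((max (-K) (min K (x i)) : ℝ) : ℂ)) (by fun_prop) |K| (fun x => by
      rw [Complex.norm_real, Real.norm_eq_abs]
      exact abs_le.mpr ⟨(neg_le_neg (le_abs_self K)).trans (le_max_left _ _),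
        max_le (neg_le_abs K) ((min_le_left _ _).trans (le_abs_self K))⟩)

theorem truncatedCoord_apply {K : ℝ} {x : Fin d → ℝ} (hx : ‖x‖ ≤ K) (i : Fin d) :
    truncatedCoord K i x = x i := by
  have h := abs_le.mp ((norm_le_pi_norm x i).trans hx)
  simp only [truncatedCoord, BoundedContinuousFunction.coe_ofNormedAddCommGroup]
  rw [min_eq_right h.2, max_eq_right h.1]

/-- Evaluation at a point is continuous and multiplicative, so it passes through the exponential
series. -/
theorem exp_boundedContinuousFunction_apply {X : Type*} [TopologicalSpace X] (a : X →ᵇ ℂ) (x : X) :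
    NormedSpace.exp a x = Complex.exp (a x) := by
  have h := (NormedSpace.exp_series_hasSum_exp' (𝕂 := ℂ) a).mapL
    (BoundedContinuousFunction.evalCLM ℂ x)
  have h' := NormedSpace.exp_series_hasSum_exp' (𝕂 := ℂ) (a x)
  rw [Complex.exp_eq_exp_ℂ]
  refine h.unique ?_
  convert h' using 2 with n
  simp [BoundedContinuousFunction.evalCLM_apply]

/-- The exponential `x ↦ exp(2πi z·x)` with complex frequency `z` and truncated coordinates. -/
def complexExpo (K : ℝ) (z : Fin d → ℂ) : (Fin d → ℝ) →ᵇ ℂ :=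
  NormedSpace.exp (∑ i, (2 * Real.pi * Complex.I * z i) • truncatedCoord K i)

/-- The exponential of a Banach algebra is analytic and the exponent is linear in `z`. Truncating
the coordinates puts the exponent into an algebra of bounded functions, without changing anything on
the ball of radius `K`. -/
theorem differentiable_complexExpo (K : ℝ) :
    Differentiable ℂ (complexExpo K : (Fin d → ℂ) → (Fin d → ℝ) →ᵇ ℂ) := by
  intro z
  unfold complexExpo
  refine (NormedSpace.exp_analytic (𝕂 := ℂ) _).differentiableAt.comp z ?_
  fun_prop

theorem complexExpo_apply (K : ℝ) (z : Fin d → ℂ) (x : Fin d → ℝ) :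
    complexExpo K z x = Complex.exp (∑ i, 2 * Real.pi * Complex.I * z i * truncatedCoord K i x) := by
  rw [complexExpo, exp_boundedContinuousFunction_apply]
  simp

theorem complexExpo_ofReal_apply {K : ℝ} (t : Fin d → ℝ) {x : Fin d → ℝ} (hx : ‖x‖ ≤ K) :
    complexExpo K (fun i => (t i : ℂ)) x = expo t x := by
  rw [complexExpo_apply, expo, dotProduct]
  push_cast
  rw [Finset.mul_sum]
  simp only [truncatedCoord_apply hx]
  congr 1
  exact Finset.sum_congr rfl fun i _ => by ring

variable {μ : Measure (Fin d → ℝ)} [IsFiniteMeasure μ]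

theorem toLp_complexExpo_ofReal {K : ℝ} (hK : ∀ᵐ x ∂μ, ‖x‖ ≤ K) (t : Fin d → ℝ) :
    BoundedContinuousFunction.toLp 2 μ ℂ (complexExpo K fun i => (t i : ℂ)) = expoLp μ t := by
  refine Lp.ext ?_
  filter_upwards [hK, coeFn_expoLp μ t, BoundedContinuousFunction.coeFn_toLp 2 μ ℂ
    (complexExpo K fun i => (t i : ℂ))] with x hx h1 h2
  rw [h1, h2, complexExpo_ofReal_apply t hx]

theorem toLp_star_complexExpo_neg_ofReal {K : ℝ} (hK : ∀ᵐ x ∂μ, ‖x‖ ≤ K) (t : Fin d → ℝ) :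
    BoundedContinuousFunction.toLp 2 μ ℂ (star (complexExpo K (-fun i => (t i : ℂ)))) =
      expoLp μ t := by
  have hneg : (-fun i => (t i : ℂ)) = fun i => ((-t) i : ℂ) := by
    ext i
    simp
  refine Lp.ext ?_
  filter_upwards [hK, coeFn_expoLp μ t, BoundedContinuousFunction.coeFn_toLp 2 μ ℂ
    (star (complexExpo K (-fun i => (t i : ℂ))))] with x hx h1 h2
  rw [h1, h2, BoundedContinuousFunction.star_apply, hneg, complexExpo_ofReal_apply (-t) hx,
    ← starRingEnd_apply, conj_expo, neg_neg]

/-- The quadratic form of a bounded operator on the exponentials `e_t` extends to an entire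
function of `t`, if the measure has bounded support. -/
theorem exists_entire_extension_inner {K : ℝ} (hK : ∀ᵐ x ∂μ, ‖x‖ ≤ K)
    (P : Lp ℂ 2 μ →L[ℂ] Lp ℂ 2 μ) :
    ∃ h : (Fin d → ℂ) → ℂ, Differentiable ℂ h ∧
      ∀ t : Fin d → ℝ, h (fun i => (t i : ℂ)) = inner ℂ (expoLp μ t) (P (expoLp μ t)) := by
  -- The inner product is antilinear in its first slot; composing with `star` makes `J` linear and
  -- so preserves holomorphy. The frequency `-z` compensates: `star` of `e_{-t}` is `e_t` for real
  -- `t`.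
  let J : ((Fin d → ℝ) →ᵇ ℂ) →L[ℂ] Lp ℂ 2 μ →L[ℂ] ℂ :=
    (innerSL ℂ).comp ((BoundedContinuousFunction.toLp 2 μ ℂ).comp
      (starL ℂ : ((Fin d → ℝ) →ᵇ ℂ) ≃L⋆[ℂ] ((Fin d → ℝ) →ᵇ ℂ)).toContinuousLinearMap)
  refine ⟨fun z => J (complexExpo K (-z))
    (P (BoundedContinuousFunction.toLp 2 μ ℂ (complexExpo K z))), ?_, fun t => ?_⟩
  · have h1 : Differentiable ℂ fun z : Fin d → ℂ => J (complexExpo K (-z)) :=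
      J.differentiable.comp ((differentiable_complexExpo K).comp differentiable_id.neg)
    have h2 : Differentiable ℂ fun z : Fin d → ℂ =>
        P (BoundedContinuousFunction.toLp 2 μ ℂ (complexExpo K z)) :=
      P.differentiable.comp ((BoundedContinuousFunction.toLp 2 μ ℂ).differentiable.comp
        (differentiable_complexExpo K))
    exact h1.clm_apply h2
  · change inner ℂ (BoundedContinuousFunction.toLp 2 μ ℂ
      (star (complexExpo K (-fun i => (t i : ℂ))))) _ = _
    rw [toLp_star_complexExpo_neg_ofReal hK, toLp_complexExpo_ofReal hK]

end EntireExtension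

end

end SelfAffine

/-- The operators `branch` are defined on `L²(μ)` by the invariance of `μ` alone, and they stand
in for the adjoints of the isometries `f ↦ α_l e_l · f ∘ 𝓡`; the isometries themselves, whose
definition needs the no overlap condition, are not used. -/
theorem theorem1p3 {d : ℕ} (R : Matrix (Fin d) (Fin d) ℤ) (hR : SelfAffine.IsExpansive R)
    (B : Finset (Fin d → ℤ)) (hB : (0 : Fin d → ℤ) ∈ B)
    (μ : Measure (Fin d → ℝ)) [IsProbabilityMeasure μ]
    (hμ : SelfAffine.IsSelfAffineMeasure R B μ)
    (hoverlap : SelfAffine.NoOverlap R B μ)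
    (L : Finset (Fin d → ℤ)) (hL : (0 : Fin d → ℤ) ∈ L) (α : L → ℂ)
    (hα : α ⟨0, hL⟩ = 1)
    (hT : (SelfAffine.weightMatrix R B L α)ᴴ * SelfAffine.weightMatrix R B L α = 1)
    (hfix : ∀ h : (Fin d → ℂ) → ℂ, Differentiable ℂ h →
      (∀ t : Fin d → ℝ, (h (fun i => (t i : ℂ))).im = 0 ∧
        0 ≤ (h (fun i => (t i : ℂ))).re ∧ (h (fun i => (t i : ℂ))).re ≤ 1) →
      h 0 = 1 → SelfAffine.IsTransferFixed R B L α h → ∀ z, h z = 1) :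
    SelfAffine.IsParsevalFrame (SelfAffine.weightedExpo R α μ) := by
  open SelfAffine in
  have hbessel := sum_norm_sq_inner_weightedExpo_le hR hμ hL hα hT
  set Θ := analysisOp (weightedExpo R α μ) hbessel with hΘ
  have hΘ1 : ‖Θ‖ ≤ 1 := norm_analysisOp_le hbessel
  have hsum : ∀ f, HasSum (fun w => ‖inner ℂ (weightedExpo R α μ w) f‖ ^ 2) (‖Θ f‖ ^ 2) :=
    hasSum_norm_sq_analysisOp hbessel
  have hle : ∀ t, ‖Θ (expoLp μ t)‖ ≤ 1 := fun t => by
    simpa [norm_expoLp] using Θ.le_of_opNorm_le hΘ1 (expoLp μ t)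
  have hrec : ∀ f, ‖Θ f‖ ^ 2 = ∑ l : L, ‖Θ (branch hμ l.1 (α l) f)‖ ^ 2 := by
    have henn : ∀ f, ∑' w, ‖inner ℂ (weightedExpo R α μ w) f‖ₑ ^ 2 =
        ENNReal.ofReal (‖Θ f‖ ^ 2) := fun f => by
      rw [← (hsum f).tsum_eq, ENNReal.ofReal_tsum_of_nonneg (fun _ => by positivity)
        (hsum f).summable]
      simp only [ENNReal.ofReal_pow (norm_nonneg _), ofReal_norm]
    intro f
    have h := tsum_enorm_sq_inner_weightedExpo_eq_sum_branch hR hμ hL hα f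
    simp only [henn] at h
    rwa [← ENNReal.ofReal_sum_of_nonneg (fun _ _ => by positivity),
      ENNReal.ofReal_eq_ofReal_iff (by positivity) (by positivity)] at h
  obtain ⟨K, hK⟩ := hμ.exists_ae_norm_le hR
  obtain ⟨h, hdiff, hval⟩ := exists_entire_extension_inner hK
    ((ContinuousLinearMap.adjoint Θ).comp Θ)
  have hval' : ∀ t : Fin d → ℝ, h (fun i => (t i : ℂ)) = ((‖Θ (expoLp μ t)‖ ^ 2 : ℝ) : ℂ) :=
    fun t => by
      rw [hval, ContinuousLinearMap.comp_apply, ContinuousLinearMap.adjoint_inner_right,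
        inner_self_eq_norm_sq_to_K]
      push_cast
      rfl
  have hone : ∀ z, h z = 1 := by
    refine hfix h hdiff (fun t => ?_) ?_ fun t => ?_
    · rw [hval']
      exact ⟨Complex.ofReal_im _, by rw [Complex.ofReal_re]; positivity,
        by rw [Complex.ofReal_re]; exact pow_le_one₀ (norm_nonneg _) (hle t)⟩
    · have h0 : (0 : Fin d → ℂ) = fun i => (((0 : Fin d → ℝ) i : ℝ) : ℂ) := by
        ext i
        simp
      -- The empty word contributes `|⟨e_0, e_0⟩|² = 1` on its own, which already meets the upper
      -- bound.
      have h1 : ‖Θ (expoLp μ 0)‖ ^ 2 = 1 := by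
        refine le_antisymm (pow_le_one₀ (norm_nonneg _) (hle 0)) ?_
        let e : Words L := ⟨[], fun h => absurd rfl h⟩
        have h2 : weightedExpo R α μ e = expoLp μ 0 := by
          simp [weightedExpo, e, frequency_nil, toReal_zero]
        have h3 := le_hasSum (hsum (expoLp μ 0)) e fun _ _ => by positivity
        rw [h2, inner_self_eq_norm_sq_to_K, norm_expoLp] at h3
        simpa using h3
      rw [h0, hval', h1, Complex.ofReal_one]
    -- The fixed point equation is the recursion `hrec` at `e_t`, the scalars produced by the
    -- branches being the weights of the transfer operator.
    · simp only [hval']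
      rw [hrec (expoLp μ t)]
      push_cast
      refine Finset.sum_congr rfl fun l _ => ?_
      rw [branch_expoLp, map_smul, norm_smul, norm_mul, RCLike.norm_conj]
      push_cast
      ring
  have hiso : ∀ t, ‖Θ (expoLp μ t)‖ = ‖expoLp μ t‖ := fun t => by
    have h1 := hval' t
    rw [hone] at h1
    have h2 : ‖Θ (expoLp μ t)‖ ^ 2 = 1 := by exact_mod_cast h1.symm
    rw [norm_expoLp]
    exact (pow_eq_one_iff_of_nonneg (norm_nonneg _) two_ne_zero).mp h2
  intro v
  rw [← norm_eq_of_norm_eq_on_total Θ hΘ1 (expoLp μ)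
    (eq_zero_of_forall_inner_expoLp_eq_zero) hiso v]
  exact hsum v
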